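/- Let $q$ be an odd prime power, $t\in\{3,4\}$, $n=2t$, and let $s\in\mathbb N$ with $\gcd(s,n)=1$. Let $\tilde{\mathcal L}_{n,q}$ be the set of $q$-polynomials $\sum_{i=0}^{n-1}c_ix^{q^i}$ with $c_i\in\mathbb F_{q^n}$, identified with the $\mathbb F_q$-linear maps $\mathbb F_{q^n}\to\mathbb F_{q^n}$ (exponents $i$ in $x^{q^i}$ are read modulo $n$). Two codes $\mathcal C,\mathcal C'\subseteq\tilde{\mathcal L}_{n,q}$ are equivalent if $\mathcal C'=\{L_1\circ f^{\rho}\circ L_2: f\in\mathcal C\}$ for some $\rho\in\mathrm{Aut}(\mathbb F_{q^n})$, acting on coefficients, and some $L_1,L_2\in\tilde{\mathcal L}_{n,q}$ that permute $\mathbb F_{q^n}$. Let $h\in\mathbb F_{q^n}$ with $\mathrm N_{q^n/q^t}(h)=h^{q^t+1}=-1$, and let $$\mathcal C_{h,t,s}=\big\langle x,\ x^{q^s}+x^{q^{s(t-1)}}+h^{1+q^s}x^{q^{s(t+1)}}+h^{1-q^{s(2t-1)}}x^{q^{s(2t-1)}}\big\rangle_{\mathbb F_{q^n}}.$$ (a)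 For every $\eta\in\mathbb F_{q^n}$ with $\mathrm N_{q^n/q}(\eta)\neq 1$, the generalized twisted Gabidulin code $\mathcal H_{2,s}(\eta)=\langle x,\ \eta x^{q^s}+x^{q^{s(n-1)}}\rangle_{\mathbb F_{q^n}}$ and $\mathcal C_{h,t,s}$ are not equivalent; nor are the Gabidulin code $\mathcal G_{2,s}=\langle x,x^{q^s}\rangle_{\mathbb F_{q^n}}$ and $\mathcal C_{h,t,s}$. (b) For every $\delta\in\mathbb F_{q^n}$ with $\mathrm N_{q^n/q^t}(\delta)\notin\{0,1\}$, the codes $\mathcal K_{2t,s,\delta}=\langle x,\ \delta x^{q^s}+x^{q^{s+t}}\rangle_{\mathbb F_{q^n}}$ and $\mathcal C_{h,t,s}$ are not equivalent. (c) If $t=3$, then for every $\zeta\in\mathbb F_{q^6}$ with $\zeta^2+\zeta=1$, the codes $\mathcal Z_{6,\zeta}=\langle x,\ x^q+x^{q^3}+\zeta x^{q^5}\rangle_{\mathbb F_{q^6}}$ and $\mathcal C_{h,3,s}$ are equivalent if and only if $h\in\mathbb F_q$ and $q$ is a power of $5$. -/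

import Mathlib

/-- A reduced `q`-polynomial `∑_{i < n} c_i x^{q^i}` over `F`, given by its coefficients. When `F`
has `q ^ n` elements, these are the classes of the `q`-polynomials modulo `x^{q^n} - x`. -/
abbrev QPoly (n : ℕ) (F : Type*) := Fin n → F

namespace QPoly

variable {F : Type*} [Field F]

/-- The map `F → F` defined by a `q`-polynomial, `x ↦ ∑_{i < n} c_i x^{q^i}`. -/
def eval (q : ℕ) {n : ℕ} (f : QPoly n F) (x : F) : F :=
  ∑ i : Fin n, f i * x ^ q ^ (i : ℕ)

/-- The monomial `x^{q^j}`, the exponent `j` being taken modulo `n`. -/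
def mono (n j : ℕ) : QPoly n F := fun i => if (i : ℕ) = j % n then 1 else 0

/-- Over a field with `q ^ n` elements, `mono n j` is the map `x ↦ x^{q^j}`. -/
theorem eval_mono [Finite F] (q : ℕ) {n : ℕ} (hn : 0 < n) (hF : Nat.card F = q ^ n) (j : ℕ)
    (x : F) : eval q (mono n j) x = x ^ q ^ j := by
  have : Fintype F := Fintype.ofFinite F
  have hx : ∀ y : F, y ^ q ^ n = y := fun y => by
    rw [← hF, Nat.card_eq_fintype_card]; exact FiniteField.pow_card y
  have hk : ∀ k : ℕ, ∀ y : F, y ^ q ^ (n * k) = y := fun k => by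
    induction k with
    | zero => intro y; simp
    | succ k ih => intro y; rw [Nat.mul_succ, pow_add, pow_mul, ih, hx]
  have h1 : eval q (mono n j) x = x ^ q ^ (j % n) := by
    unfold eval mono
    rw [Finset.sum_eq_single (⟨j % n, Nat.mod_lt j hn⟩ : Fin n)]
    · simp
    · intro b _ hb
      have : (b : ℕ) ≠ j % n := fun h => hb (Fin.ext h)
      simp [this]
    · simp
  rw [h1]
  conv_rhs => rw [← Nat.div_add_mod j n, pow_add, pow_mul, hk]

/-- The `q`-polynomial `f^ρ` obtained by applying a field automorphism to the coefficients. -/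
def twist {n : ℕ} (ρ : F ≃+* F) (f : QPoly n F) : QPoly n F := fun i => ρ (f i)

/-- Equivalence of two codes of `q`-polynomials:
`C' = {L₁ ∘ f^ρ ∘ L₂ : f ∈ C}` for an automorphism `ρ` of the field `F` and
two `q`-polynomials `L₁`, `L₂` that permute `F`. -/
def CodeEquiv (q : ℕ) {n : ℕ} (C C' : Submodule F (QPoly n F)) : Prop :=
  ∃ (ρ : F ≃+* F) (L₁ L₂ : QPoly n F),
    Function.Bijective (eval q L₁) ∧ Function.Bijective (eval q L₂) ∧
      (C' : Set (QPoly n F)) = {g | ∃ f ∈ C, eval q g = eval q L₁ ∘ eval q (twist ρ f) ∘ eval q L₂}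

/-- The code `C_f = ⟨x, f(x)⟩`, the span over the big field `F`. -/
def code {n : ℕ} (f : QPoly n F) : Submodule F (QPoly n F) :=
  Submodule.span F {mono n 0, f}

/-- The norm of the field with `q^{rm}` elements over its subfield with `q^r` elements,
as the product of the `m` conjugates `x^{q^{ri}}`. -/
def fieldNorm (q r m : ℕ) (x : F) : F := ∏ i ∈ Finset.range m, x ^ q ^ (r * i)

/-- The polynomial
`ψ_{h,t,s} = x^{q^s} + x^{q^{s(t-1)}} + h^{1+q^s} x^{q^{s(t+1)}}
  + h^{1-q^{s(2t-1)}} x^{q^{s(2t-1)}}`. -/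
def psi (q t s : ℕ) (h : F) : QPoly (2 * t) F :=
  mono (2 * t) s + mono (2 * t) (s * (t - 1))
    + h ^ (1 + q ^ s) • mono (2 * t) (s * (t + 1))
    + (h / h ^ q ^ (s * (2 * t - 1))) • mono (2 * t) (s * (2 * t - 1))

/-- The code `C_{h,t,s}`. -/
def codeC (q t s : ℕ) (h : F) : Submodule F (QPoly (2 * t) F) := code (psi q t s h)

/-- The Gabidulin code `G_{2,s} = ⟨x, x^{q^s}⟩`. -/
def codeG (n s : ℕ) : Submodule F (QPoly n F) := code (mono n s)

/-- The generalized twisted Gabidulin code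
`H_{2,s}(η) = ⟨x, η x^{q^s} + x^{q^{s(n-1)}}⟩`. -/
def codeH (n s : ℕ) (η : F) : Submodule F (QPoly n F) :=
  code (η • mono n s + mono n (s * (n - 1)))

/-- The code `K_{n,s,δ} = ⟨x, δ x^{q^s} + x^{q^{s+n/2}}⟩`, for even `n`. -/
def codeK (n s : ℕ) (δ : F) : Submodule F (QPoly n F) :=
  code (δ • mono n s + mono n (s + n / 2))

/-- The code `Z_{6,ζ} = ⟨x, x^q + x^{q^3} + ζ x^{q^5}⟩`; it is used for `n = 6` only. -/
def codeZ (n : ℕ) (ζ : F) : Submodule F (QPoly n F) :=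
  code (mono n 1 + mono n 3 + ζ • mono n 5)

end QPoly

/-!
Write `σ` for `x ↦ x^{q^s}`, a generator of the Galois group of `F` over its subfield with `q`
elements. By Dedekind's independence of characters (`linearIndependent_pow`), a `q`-polynomial is
determined by its map, and identities between combinations of powers of `σ` may be compared
coefficient by coefficient.

Suppose `⟨x, ψ⟩ = L₁ ∘ ⟨x, f^ρ⟩ ∘ L₂`. As `ψ` has two terms with coefficient `1`, the left idealizer
of `⟨x, ψ⟩` consists of the scalars only (`psiSix_idealizer`, `psiEight_idealizer`). Both codes are
stable under left multiplication by scalars, so `L₁` normalizes the scalars and hence is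
`ℓ τ` with `τ` a field automorphism. Moving `τ` past the code shows that, up to an automorphism
acting on the coefficients of `f`, the composition `f ∘ (a x + b ψ)` equals `c x + d ψ` for some
`a, b, c, d` with `(a, b) ≠ (0, 0)` (`CodeEquiv.exists_comp`). No maximality of the rank distance
is needed.

Comparing coefficients in this identity, and using `h^{1 + σ^t} = -1` to eliminate, gives a
contradiction for the Gabidulin codes, for `η x^σ + x^{σ^{-1}}` and for `δ x^σ + x^{σ^{t+1}}`.
For `t = 4` it helps that all terms of `f` and `ψ` are odd powers of `σ`. For the trinomial
`x^q + x^{q^3} + ζ x^{q^5}`, which is a trinomial in `σ` with the end coefficients possibly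
exchanged, the elimination leaves linear relations between the conjugates of `b` under `σ²`; they
are solvable only if `h^σ = h` and `(ζ - 1)³ = 1`, and together with `ζ² + ζ = 1` the latter means
`5 = 0` (`psiSix_trinomial`). Conversely, in characteristic five `ζ = 2`, all coefficients lie in
the prime field, and the substitution `±x + ψ(x)`, which is invertible, is an equivalence
(`codeEquiv_of_comp`).
-/

namespace QPoly

variable {F : Type*} [Field F]

/-! ### Evaluation of reduced `q`-polynomials -/

theorem eval_add (q : ℕ) {n : ℕ} (f g : QPoly n F) (x : F) :
    eval q (f + g) x = eval q f x + eval q g x := by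
  simp [eval, add_mul, Finset.sum_add_distrib]

theorem eval_sum (q : ℕ) {n : ℕ} {ι : Type*} (S : Finset ι) (f : ι → QPoly n F) (x : F) :
    eval q (∑ i ∈ S, f i) x = ∑ i ∈ S, eval q (f i) x := by
  simp only [eval, Finset.sum_apply, Finset.sum_mul]
  exact Finset.sum_comm

theorem eval_smul (q : ℕ) {n : ℕ} (c : F) (f : QPoly n F) (x : F) :
    eval q (c • f) x = c * eval q f x := by
  simp [eval, Finset.mul_sum, mul_assoc]

theorem twist_add {n : ℕ} (ρ : F ≃+* F) (f g : QPoly n F) :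
    twist ρ (f + g) = twist ρ f + twist ρ g := by
  funext i; simp [twist]

theorem twist_smul {n : ℕ} (ρ : F ≃+* F) (c : F) (f : QPoly n F) :
    twist ρ (c • f) = ρ c • twist ρ f := by
  funext i; simp only [twist, Pi.smul_apply, smul_eq_mul, map_mul]

theorem twist_mono (ρ : F ≃+* F) (n j : ℕ) : twist ρ (mono n j) = (mono n j : QPoly n F) := by
  funext i
  change ρ (if (i : ℕ) = j % n then 1 else 0) = if (i : ℕ) = j % n then 1 else 0
  split_ifs <;> simp

theorem twist_refl {n : ℕ} (f : QPoly n F) : twist (RingEquiv.refl F) f = f := rfl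

theorem mono_congr {n i j : ℕ} (hij : i % n = j % n) : (mono n i : QPoly n F) = mono n j := by
  unfold mono; rw [hij]

theorem map_eval {q n : ℕ} (τ : F ≃+* F) (f : QPoly n F) (x : F) :
    τ (eval q f x) = eval q (twist τ f) (τ x) := by
  simp [eval, twist]

theorem mem_code {n : ℕ} {f g : QPoly n F} : g ∈ code f ↔ ∃ a b : F, a • mono n 0 + b • f = g :=
  Submodule.mem_span_pair

section Finite

variable [Finite F] {q n : ℕ}

theorem one_lt_of_card (hn : 0 < n) (hF : Nat.card F = q ^ n) : 1 < q := by
  have h1 : 1 < Nat.card F := Finite.one_lt_card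
  rw [hF] at h1
  exact (Nat.one_lt_pow_iff hn.ne').1 h1

theorem exists_char_pow (hn : 0 < n) (hF : Nat.card F = q ^ n) :
    ∃ p e : ℕ, p.Prime ∧ CharP F p ∧ q = p ^ e := by
  have : Fintype F := Fintype.ofFinite F
  obtain ⟨p, hp, m, hpp, hm⟩ := FiniteField.card' F
  rw [← Nat.card_eq_fintype_card, hF] at hm
  obtain ⟨e, -, he⟩ := (Nat.dvd_prime_pow hpp).1 (hm ▸ dvd_pow_self q hn.ne')
  exact ⟨p, e, hpp, hp, he⟩

theorem exists_ringHom_pow (hn : 0 < n) (hF : Nat.card F = q ^ n) (j : ℕ) :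
    ∃ σ : F →+* F, ∀ x, σ x = x ^ q ^ j := by
  obtain ⟨p, e, hp, hchar, rfl⟩ := exists_char_pow hn hF
  have : ExpChar F p := ExpChar.prime hp
  exact ⟨iterateFrobenius F p (e * j), fun x => by rw [iterateFrobenius_def, pow_mul]⟩

/-- The additivity of a `q`-polynomial in its argument. -/
theorem eval_map_add (hn : 0 < n) (hF : Nat.card F = q ^ n) (f : QPoly n F) (x y : F) :
    eval q f (x + y) = eval q f x + eval q f y := by
  have key : ∀ j, (x + y) ^ q ^ j = x ^ q ^ j + y ^ q ^ j := fun j => by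
    obtain ⟨σ, hσ⟩ := exists_ringHom_pow hn hF j
    simp only [← hσ, map_add]
  simp [eval, key, mul_add, Finset.sum_add_distrib]

theorem eval_mono_zero (hn : 0 < n) (hF : Nat.card F = q ^ n) (x : F) :
    eval q (mono n 0) x = x := by
  rw [eval_mono q hn hF]; simp

/-- The maps `x ↦ x^{q^j}` are distinct for distinct residues of `j` modulo `n`: on the cyclic group
of units, two that agree for `i < j < n` would make `q^n - 1` divide `q^j - q^i`. -/
theorem mod_eq_of_pow_eq (hn : 0 < n) (hF : Nat.card F = q ^ n) {i j : ℕ}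
    (hij : ∀ x : F, x ^ q ^ i = x ^ q ^ j) : i % n = j % n := by
  have : Fintype F := Fintype.ofFinite F
  have hq : 1 < q := one_lt_of_card hn hF
  have hred : ∀ (k : ℕ) (x : F), x ^ q ^ k = x ^ q ^ (k % n) := fun k x => by
    rw [← eval_mono q hn hF, ← eval_mono q hn hF, mono_congr (Nat.mod_mod k n).symm]
  have key : ∀ a b : ℕ, a < b → b < n → ¬ ∀ x : F, x ^ q ^ a = x ^ q ^ b := by
    intro a b hab hbn h
    have hlt : q ^ a < q ^ b := Nat.pow_lt_pow_right hq hab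
    have h1 : ∀ x : Fˣ, x ^ (q ^ b - q ^ a) = 1 := fun x => by
      have h2 : x ^ q ^ a = x ^ q ^ b := Units.ext (by simpa using h (x : F))
      have h3 : x ^ (q ^ b - q ^ a) * x ^ q ^ a = 1 * x ^ q ^ a := by
        rw [← pow_add, Nat.sub_add_cancel hlt.le, ← h2, one_mul]
      exact mul_right_cancel h3
    rw [FiniteField.forall_pow_eq_one_iff, ← Nat.card_eq_fintype_card, hF] at h1
    have h4 := Nat.le_of_dvd (Nat.sub_pos_of_lt hlt) h1
    have h5 : q ^ b < q ^ n := Nat.pow_lt_pow_right hq hbn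
    have h6 : 0 < q ^ a := by positivity
    omega
  have hi := Nat.mod_lt i hn
  have hj := Nat.mod_lt j hn
  have h : ∀ x : F, x ^ q ^ (i % n) = x ^ q ^ (j % n) := fun x => by rw [← hred, ← hred, hij]
  rcases lt_trichotomy (i % n) (j % n) with hlt | heq | hgt
  · exact (key _ _ hlt hj h).elim
  · exact heq
  · exact (key _ _ hgt hi fun x => (h x).symm).elim

/-- Dedekind's independence of characters for the powers of a generator `x ↦ x^{q^s}` of the
Galois group of `F` over its subfield with `q` elements. -/
theorem linearIndependent_pow (hn : 0 < n) (hF : Nat.card F = q ^ n) {s : ℕ}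
    (hs : Nat.Coprime n s) :
    LinearIndependent F (fun (k : Fin n) (x : F) => x ^ q ^ (s * (k : ℕ))) := by
  refine (linearIndependent_monoidHom F F).comp (fun k : Fin n => powMonoidHom (q ^ (s * k))) ?_
  intro i j hij
  have h1 : s * (i : ℕ) % n = s * (j : ℕ) % n :=
    mod_eq_of_pow_eq hn hF fun x => DFunLike.congr_fun hij x
  have h2 : (i : ℕ) ≡ j [MOD n] := Nat.ModEq.cancel_left_of_coprime hs h1
  have h3 : (i : ℕ) % n = j % n := h2
  rw [Nat.mod_eq_of_lt i.2, Nat.mod_eq_of_lt j.2] at h3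
  exact Fin.ext h3

theorem eval_injective (hn : 0 < n) (hF : Nat.card F = q ^ n) :
    Function.Injective (eval q : QPoly n F → F → F) := by
  intro f g hfg
  have hli := Fintype.linearIndependent_iff.1
    (linearIndependent_pow hn hF (Nat.coprime_one_right n))
  ext i
  refine sub_eq_zero.1 (hli (fun i => f i - g i) ?_ i)
  ext x
  have := congrFun hfg x
  simp only [eval] at this
  simp [sub_mul, this]

/-- Over a finite field, `q`-polynomials are closed under composition. -/
theorem exists_eval_comp (hn : 0 < n) (hF : Nat.card F = q ^ n) (f g : QPoly n F) :
    ∃ k : QPoly n F, eval q k = eval q f ∘ eval q g := by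
  refine ⟨∑ j, ∑ i, (f j * g i ^ q ^ (j : ℕ)) • mono n ((i : ℕ) + j), ?_⟩
  funext x
  simp only [eval_sum, eval_smul, eval_mono q hn hF, Function.comp]
  conv_rhs => rw [eval]
  refine Finset.sum_congr rfl fun j _ => ?_
  obtain ⟨σ, hσ⟩ := exists_ringHom_pow hn hF (j : ℕ)
  simp only [← hσ, eval, map_sum, map_mul, map_pow, Finset.mul_sum, pow_add, pow_mul, mul_assoc]

/-! ### Equivalence of two-dimensional codes -/

/-- The adjoint map `L₁` of an equivalence normalizes the scalars as soon as the left idealizer of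
the target code consists of scalars (hypothesis `hid`). Then `L₁ = ℓ τ` for a field automorphism
`τ`, which can be moved past the code, so that only an inner substitution `a x + b f'(x)`
remains. -/
theorem CodeEquiv.exists_comp (hn : 0 < n) (hF : Nat.card F = q ^ n) {f f' : QPoly n F}
    (hid : ∀ b : F, (∀ γ : F, ∃ e g : F, ∀ x,
      b * eval q f' (γ * x) = e * x + g * eval q f' x) → b = 0)
    (H : CodeEquiv q (code f) (code f')) :
    ∃ (ρ : F ≃+* F) (a b c d : F), ¬ (a = 0 ∧ b = 0) ∧
      ∀ x, eval q (twist ρ f) (a * x + b * eval q f' x) = c * x + d * eval q f' x := by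
  obtain ⟨ρ, L₁, L₂, hL₁, hL₂, hC⟩ := H
  have hx : ∀ x : F, eval q (mono n 0) x = x := eval_mono_zero hn hF
  -- the two inclusions of the equality of codes, in terms of maps
  have hto : ∀ c d : F, ∃ a b : F, ∀ x, a * x + b * eval q f' x =
      eval q L₁ (c * eval q L₂ x + d * eval q (twist ρ f) (eval q L₂ x)) := by
    intro c d
    obtain ⟨k, hk⟩ := exists_eval_comp hn hF
      (twist ρ (ρ.symm c • mono n 0 + ρ.symm d • f)) L₂
    obtain ⟨g, hg⟩ := exists_eval_comp hn hF L₁ k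
    have hmem : g ∈ (code f' : Set (QPoly n F)) := by
      rw [hC]
      exact ⟨_, mem_code.2 ⟨ρ.symm c, ρ.symm d, rfl⟩, by rw [hg, hk]⟩
    obtain ⟨a, b, rfl⟩ := mem_code.1 hmem
    refine ⟨a, b, fun x => ?_⟩
    have := congrFun hg x
    simpa only [hk, Function.comp, twist_add, twist_smul, twist_mono, eval_add, eval_smul, hx,
      RingEquiv.apply_symm_apply] using this
  have hfrom : ∀ a b : F, ∃ c d : F, ∀ x, a * x + b * eval q f' x =
      eval q L₁ (c * eval q L₂ x + d * eval q (twist ρ f) (eval q L₂ x)) := by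
    intro a b
    have hmem : a • mono n 0 + b • f' ∈ (code f' : Set (QPoly n F)) := mem_code.2 ⟨a, b, rfl⟩
    rw [hC] at hmem
    obtain ⟨g, hg, hge⟩ := hmem
    obtain ⟨c, d, rfl⟩ := mem_code.1 hg
    refine ⟨ρ c, ρ d, fun x => ?_⟩
    have := congrFun hge x
    simpa only [Function.comp, twist_add, twist_smul, twist_mono, eval_add, eval_smul, hx]
      using this
  -- conjugating a scalar by `L₁` gives an element of the left idealizer, hence a scalar
  have hscal : ∀ α : F, ∃ μ : F, ∀ y, eval q L₁ (α * y) = μ * eval q L₁ y := by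
    intro α
    obtain ⟨c, d, hM⟩ := hfrom 1 0
    obtain ⟨a, b, hab⟩ := hto (α * c) (α * d)
    have hM' : ∀ x, c * eval q L₂ x + d * eval q (twist ρ f) (eval q L₂ x) =
        (Equiv.ofBijective _ hL₁).symm x := fun x => by
      rw [Equiv.eq_symm_apply, Equiv.ofBijective_apply, ← hM]; ring
    have hconj : ∀ y, eval q L₁ (α * y) = a * eval q L₁ y + b * eval q f' (eval q L₁ y) := by
      intro y
      rw [hab, mul_assoc, mul_assoc, ← mul_add, hM']
      congr 2
      exact ((Equiv.ofBijective _ hL₁).symm_apply_apply y).symm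
    have hb : b = 0 := by
      refine hid b fun γ => ?_
      obtain ⟨c', d', hN⟩ := hfrom γ 0
      obtain ⟨a', b', hab'⟩ := hto (α * c') (α * d')
      refine ⟨a' - a * γ, b', fun x => ?_⟩
      have h1 := hconj (c' * eval q L₂ x + d' * eval q (twist ρ f) (eval q L₂ x))
      rw [← hN, mul_add, ← mul_assoc, ← mul_assoc, ← hab', zero_mul, add_zero] at h1
      linear_combination -h1
    exact ⟨a, fun y => by rw [hconj, hb]; ring⟩
  choose μ hμ using hscal
  have hadd := eval_map_add hn hF L₁
  have hL₁0 : eval q L₁ 0 = 0 := by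
    have := hadd 0 0
    rw [add_zero] at this
    linear_combination -this
  have hl : eval q L₁ 1 ≠ 0 := fun h => one_ne_zero (hL₁.1 (h.trans hL₁0.symm))
  have hμ1 : ∀ y, eval q L₁ y = μ y * eval q L₁ 1 := fun y => by rw [← hμ, mul_one]
  let τ₀ : F →+* F :=
    { toFun := μ
      map_one' := mul_right_cancel₀ hl (by rw [← hμ1, one_mul])
      map_zero' := mul_right_cancel₀ hl (by rw [← hμ1, zero_mul, hL₁0])
      map_mul' := fun x y => mul_right_cancel₀ hl (by rw [← hμ1, hμ, hμ1 y, mul_assoc])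
      map_add' := fun x y => mul_right_cancel₀ hl (by rw [← hμ1, hadd, hμ1 x, hμ1 y, add_mul]) }
  let τ : F ≃+* F := RingEquiv.ofBijective τ₀ (Finite.injective_iff_bijective.1 τ₀.injective)
  obtain ⟨l, hl, hτ⟩ : ∃ l : F, l ≠ 0 ∧ ∀ y, eval q L₁ y = τ y * l := ⟨_, hl, hμ1⟩
  obtain ⟨a, b, hab⟩ := hto 1 0
  obtain ⟨c, d, hcd⟩ := hto 0 1
  simp only [one_mul, zero_mul, add_zero, zero_add, hτ] at hab hcd
  have hL : ∀ x, l⁻¹ * a * x + l⁻¹ * b * eval q f' x = τ (eval q L₂ x) := fun x => by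
    rw [mul_assoc, mul_assoc, ← mul_add, hab, mul_comm, mul_inv_cancel_right₀ hl]
  refine ⟨ρ.trans τ, l⁻¹ * a, l⁻¹ * b, l⁻¹ * c, l⁻¹ * d, ?_, fun x => ?_⟩
  · rintro ⟨h1, h2⟩
    obtain ⟨x, hx1⟩ := hL₂.2 1
    have := hL x
    rw [h1, h2, hx1, map_one] at this
    simp at this
  · have h1 : twist (ρ.trans τ) f = twist τ (twist ρ f) := rfl
    rw [hL, h1, ← map_eval, mul_assoc, mul_assoc, ← mul_add, hcd, mul_comm,
      mul_inv_cancel_right₀ hl]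

/-- A substitution `a x + b f'(x)` which carries `f` into `⟨x, f'(x)⟩` and is invertible on both
levels gives an equivalence, with trivial outer map and trivial automorphism. -/
theorem codeEquiv_of_comp (hn : 0 < n) (hF : Nat.card F = q ^ n) {f f' : QPoly n F}
    {a b c d : F} (hdet : a * d - b * c ≠ 0)
    (hinj : Function.Injective fun x => a * x + b * eval q f' x)
    (hcomp : ∀ x, eval q f (a * x + b * eval q f' x) = c * x + d * eval q f' x) :
    CodeEquiv q (code f) (code f') := by
  have hx : ∀ x : F, eval q (mono n 0) x = x := eval_mono_zero hn hF
  have hid : eval q (mono n 0 : QPoly n F) = id := funext hx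
  have hL : eval q (a • mono n 0 + b • f') = fun x => a * x + b * eval q f' x := by
    funext x; simp only [eval_add, eval_smul, hx]
  refine ⟨RingEquiv.refl F, mono n 0, a • mono n 0 + b • f', hid ▸ Function.bijective_id,
    Finite.injective_iff_bijective.1 (hL ▸ hinj), ?_⟩
  ext g
  constructor
  · intro hg
    obtain ⟨u, v, rfl⟩ := mem_code.1 hg
    -- Cramer's rule
    obtain ⟨u', v', hu, hv⟩ : ∃ u' v' : F, u' * a + v' * c = u ∧ u' * b + v' * d = v :=
      ⟨(u * d - v * c) * (a * d - b * c)⁻¹, (v * a - u * b) * (a * d - b * c)⁻¹,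
        by linear_combination u * mul_inv_cancel₀ hdet,
        by linear_combination v * mul_inv_cancel₀ hdet⟩
    refine ⟨_, mem_code.2 ⟨u', v', rfl⟩, funext fun x => ?_⟩
    simp only [Function.comp, twist_refl, eval_add, eval_smul, hx, hcomp]
    linear_combination -x * hu - eval q f' x * hv
  · rintro ⟨k, hk, hg⟩
    obtain ⟨u, v, rfl⟩ := mem_code.1 hk
    refine mem_code.2 ⟨u * a + v * c, u * b + v * d, eval_injective hn hF (funext fun x => ?_)⟩
    rw [hg]
    simp only [Function.comp, twist_refl, eval_add, eval_smul, hx, hcomp]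
    ring

end Finite

/-! ### The case `t = 3`, in terms of a field endomorphism of order six -/

/-- The map of `ψ_{h,3,s}` in terms of `σ = (x ↦ x^{q^s})`; the last coefficient
`h^{1-σ⁵}` is `-h h^{σ²}`, since `h^{σ²} h^{σ⁵} = -1`. -/
def psiSix (σ : F →+* F) (h x : F) : F :=
  σ x + σ (σ x) + h * σ h * σ (σ (σ (σ x))) - h * σ (σ h) * σ (σ (σ (σ (σ x))))

/-- The powers `1, σ, …, σ⁵` are linearly independent over `F` as maps `F → F`. -/
def IndepSix (σ : F →+* F) : Prop :=
  ∀ k₀ k₁ k₂ k₃ k₄ k₅ : F, (∀ x, k₀ * x + k₁ * σ x + k₂ * σ (σ x) + k₃ * σ (σ (σ x)) +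
    k₄ * σ (σ (σ (σ x))) + k₅ * σ (σ (σ (σ (σ x)))) = 0) →
    k₀ = 0 ∧ k₁ = 0 ∧ k₂ = 0 ∧ k₃ = 0 ∧ k₄ = 0 ∧ k₅ = 0

section Six

variable {σ : F →+* F} {h : F}

/-- The left idealizer of `⟨x, ψ⟩` consists of scalars. -/
theorem psiSix_idealizer (ind : IndepSix σ) {b : F}
    (hb : ∀ γ : F, ∃ e g : F, ∀ x, b * psiSix σ h (γ * x) = e * x + g * psiSix σ h x) :
    b = 0 := by
  by_contra hb0
  have key : ∀ γ, σ γ = σ (σ γ) := by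
    intro γ
    obtain ⟨e, g, H⟩ := hb γ
    obtain ⟨-, h1, h2, -⟩ := ind (-e) (b * σ γ - g) (b * σ (σ γ) - g) 0
      (b * (h * σ h * σ (σ (σ (σ γ)))) - g * (h * σ h))
      (g * (h * σ (σ h)) - b * (h * σ (σ h) * σ (σ (σ (σ (σ γ)))))) (fun x => by
        have := H x
        simp only [psiSix, map_mul] at this
        linear_combination this)
    exact mul_left_cancel₀ hb0 (by linear_combination h1 - h2)
  have := (ind 0 1 (-1) 0 0 0 (fun x => by linear_combination key x)).2.1
  exact one_ne_zero this

/-- Comparison of coefficients in `f ∘ (a x + b ψ(x)) = c x + d ψ(x)` for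
`f = k₁ x^σ + k₃ x^{σ³} + k₄ x^{σ⁴} + k₅ x^{σ⁵}`. -/
theorem psiSix_coeff (ind : IndepSix σ) (hσ : ∀ x, σ (σ (σ (σ (σ (σ x))))) = x)
    {u₁ u₂ u₃ u₄ u₅ : F} (h₁ : σ h = u₁) (h₂ : σ u₁ = u₂) (h₃ : σ u₂ = u₃) (h₄ : σ u₃ = u₄)
    (h₅ : σ u₄ = u₅) {a b c d k₁ k₃ k₄ k₅ : F}
    (H : ∀ x, k₁ * σ (a * x + b * psiSix σ h x) + k₃ * σ (σ (σ (a * x + b * psiSix σ h x))) +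
      k₄ * σ (σ (σ (σ (a * x + b * psiSix σ h x)))) +
      k₅ * σ (σ (σ (σ (σ (a * x + b * psiSix σ h x))))) = c * x + d * psiSix σ h x) :
    k₁ * σ a + k₃ * σ (σ (σ b)) * (u₃ * u₄) + k₅ * σ (σ (σ (σ (σ b)))) = d ∧
    k₁ * σ b - k₃ * σ (σ (σ b)) * (u₃ * u₅) + k₄ * σ (σ (σ (σ b))) * (u₄ * u₅) = d ∧
    k₃ * σ (σ (σ a)) + k₁ * σ b - k₄ * σ (σ (σ (σ b))) * (u₄ * h) +
      k₅ * σ (σ (σ (σ (σ b)))) * (u₅ * h) = 0 ∧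
    k₄ * σ (σ (σ (σ a))) + k₃ * σ (σ (σ b)) - k₅ * σ (σ (σ (σ (σ b)))) * (u₅ * u₁) =
      d * (h * u₁) ∧
    k₅ * σ (σ (σ (σ (σ a)))) + k₁ * σ b * (u₁ * u₂) + k₃ * σ (σ (σ b)) +
      k₄ * σ (σ (σ (σ b))) = -d * (h * u₂) := by
  have h₆ : σ u₅ = h := by rw [← h₅, ← h₄, ← h₃, ← h₂, ← h₁, hσ]
  obtain ⟨-, e1, e2, e3, e4, e5⟩ := ind
    (k₄ * σ (σ (σ (σ b))) + k₅ * σ (σ (σ (σ (σ b)))) - k₁ * σ b * (u₁ * u₃) - c)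
    (k₁ * σ a + k₃ * σ (σ (σ b)) * (u₃ * u₄) + k₅ * σ (σ (σ (σ (σ b)))) - d)
    (k₁ * σ b - k₃ * σ (σ (σ b)) * (u₃ * u₅) + k₄ * σ (σ (σ (σ b))) * (u₄ * u₅) - d)
    (k₃ * σ (σ (σ a)) + k₁ * σ b - k₄ * σ (σ (σ (σ b))) * (u₄ * h) +
      k₅ * σ (σ (σ (σ (σ b)))) * (u₅ * h))
    (k₄ * σ (σ (σ (σ a))) + k₃ * σ (σ (σ b)) - k₅ * σ (σ (σ (σ (σ b)))) * (u₅ * u₁) -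
      d * (h * u₁))
    (k₅ * σ (σ (σ (σ (σ a)))) + k₁ * σ b * (u₁ * u₂) + k₃ * σ (σ (σ b)) +
      k₄ * σ (σ (σ (σ b))) + d * (h * u₂)) (fun x => by
        have := H x
        simp only [psiSix, map_add, map_sub, map_mul, hσ, h₁, h₂, h₃, h₄, h₅, h₆] at this
        linear_combination this)
  refine ⟨sub_eq_zero.1 e1, sub_eq_zero.1 e2, e3, sub_eq_zero.1 e4, ?_⟩
  linear_combination e5

theorem sq_ne_one_of_norm {u₃ : F} (h2 : (2 : F) ≠ 0) (h₃ : σ (σ (σ h)) = u₃)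
    (hN : h * u₃ = -1) : h ^ 2 ≠ 1 := by
  intro hh
  rcases mul_self_eq_one_iff.1 ((sq h).symm.trans hh) with rfl | rfl
  all_goals
    simp only [map_one, map_neg] at h₃
    subst h₃
    exact h2 (by linear_combination hN)

theorem map_ne_neg_of_norm {u₃ : F} (h2 : (2 : F) ≠ 0) (h₃ : σ (σ (σ h)) = u₃)
    (hN : h * u₃ = -1) : σ h ≠ -h := by
  intro hh
  refine sq_ne_one_of_norm h2 h₃ hN ?_
  simp only [hh, map_neg, neg_neg] at h₃
  rw [← h₃] at hN
  linear_combination -hN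

theorem psiSix_gabidulin (ind : IndepSix σ) (hσ : ∀ x, σ (σ (σ (σ (σ (σ x))))) = x)
    {a b c d : F}
    (H : ∀ x, σ (a * x + b * psiSix σ h x) = c * x + d * psiSix σ h x) : a = 0 ∧ b = 0 := by
  obtain ⟨e1, e2, e3, -, -⟩ := psiSix_coeff (a := a) (b := b) (c := c) (d := d)
    (k₁ := 1) (k₃ := 0) (k₄ := 0) (k₅ := 0) ind hσ
    rfl rfl rfl rfl rfl (fun x => by linear_combination H x)
  have hb : σ b = 0 := by linear_combination e3
  have ha : σ a = 0 := by linear_combination e1 - e2 + hb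
  exact ⟨(map_eq_zero σ).1 ha, (map_eq_zero σ).1 hb⟩

theorem psiSix_twisted (h2 : (2 : F) ≠ 0) (ind : IndepSix σ)
    (hσ : ∀ x, σ (σ (σ (σ (σ (σ x))))) = x) (hN : h * σ (σ (σ h)) = -1) {a b c d η : F}
    (H : ∀ x, η * σ (a * x + b * psiSix σ h x) +
      σ (σ (σ (σ (σ (a * x + b * psiSix σ h x))))) = c * x + d * psiSix σ h x) :
    a = 0 ∧ b = 0 := by
  obtain ⟨u₁, hu₁⟩ : ∃ y, σ h = y := ⟨_, rfl⟩
  obtain ⟨u₂, hu₂⟩ : ∃ y, σ u₁ = y := ⟨_, rfl⟩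
  obtain ⟨u₃, hu₃⟩ : ∃ y, σ u₂ = y := ⟨_, rfl⟩
  obtain ⟨u₄, hu₄⟩ : ∃ y, σ u₃ = y := ⟨_, rfl⟩
  obtain ⟨u₅, hu₅⟩ : ∃ y, σ u₄ = y := ⟨_, rfl⟩
  obtain ⟨-, e2, e3, e4, e5⟩ := psiSix_coeff (a := a) (b := b) (c := c) (d := d)
    (k₁ := η) (k₃ := 0) (k₄ := 0) (k₅ := 1) ind hσ
    hu₁ hu₂ hu₃ hu₄ hu₅ (fun x => by linear_combination H x)
  have hsq : h ^ 2 ≠ 1 := sq_ne_one_of_norm h2 rfl hN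
  rw [hu₁, hu₂, hu₃] at hN
  have n1 : u₁ * u₄ = -1 := by rw [← hu₁, ← hu₄, ← map_mul, hN, map_neg, map_one]
  have n2 : u₂ * u₅ = -1 := by rw [← hu₂, ← hu₅, ← map_mul, n1, map_neg, map_one]
  have hu₁0 : u₁ ≠ 0 := left_ne_zero_of_mul (n1 ▸ neg_ne_zero.2 one_ne_zero)
  have hu₅0 : u₅ ≠ 0 := right_ne_zero_of_mul (n2 ▸ neg_ne_zero.2 one_ne_zero)
  have hb : σ (σ (σ (σ (σ b)))) = 0 := by
    have : σ (σ (σ (σ (σ b)))) * (u₅ * u₁ * (h ^ 2 - 1)) = 0 := by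
      linear_combination e4 - h * u₁ * e2 + h * u₁ * e3
    exact (mul_eq_zero.1 this).resolve_right
      (mul_ne_zero (mul_ne_zero hu₅0 hu₁0) (sub_ne_zero.2 hsq))
  have hb0 : b = 0 := by simpa only [map_eq_zero] using hb
  have ha : σ (σ (σ (σ (σ a)))) = 0 := by
    simp only [hb0, map_zero] at e2 e5
    linear_combination e5 + h * u₂ * e2
  exact ⟨by simpa only [map_eq_zero] using ha, hb0⟩

theorem psiSix_dickson (h2 : (2 : F) ≠ 0) (ind : IndepSix σ)
    (hσ : ∀ x, σ (σ (σ (σ (σ (σ x))))) = x) (hN : h * σ (σ (σ h)) = -1) {a b c d δ : F}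
    (H : ∀ x, δ * σ (a * x + b * psiSix σ h x) +
      σ (σ (σ (σ (a * x + b * psiSix σ h x)))) = c * x + d * psiSix σ h x) :
    a = 0 ∧ b = 0 := by
  obtain ⟨u₁, hu₁⟩ : ∃ y, σ h = y := ⟨_, rfl⟩
  obtain ⟨u₂, hu₂⟩ : ∃ y, σ u₁ = y := ⟨_, rfl⟩
  obtain ⟨u₃, hu₃⟩ : ∃ y, σ u₂ = y := ⟨_, rfl⟩
  obtain ⟨u₄, hu₄⟩ : ∃ y, σ u₃ = y := ⟨_, rfl⟩
  obtain ⟨u₅, hu₅⟩ : ∃ y, σ u₄ = y := ⟨_, rfl⟩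
  obtain ⟨-, e2, e3, e4, e5⟩ := psiSix_coeff (a := a) (b := b) (c := c) (d := d)
    (k₁ := δ) (k₃ := 0) (k₄ := 1) (k₅ := 0) ind hσ
    hu₁ hu₂ hu₃ hu₄ hu₅ (fun x => by linear_combination H x)
  have hneg : σ h ≠ -h := map_ne_neg_of_norm h2 rfl hN
  rw [hu₁, hu₂, hu₃] at hN
  have n1 : u₁ * u₄ = -1 := by rw [← hu₁, ← hu₄, ← map_mul, hN, map_neg, map_one]
  have n2 : u₂ * u₅ = -1 := by rw [← hu₂, ← hu₅, ← map_mul, n1, map_neg, map_one]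
  have hu₂0 : u₂ ≠ 0 := left_ne_zero_of_mul (n2 ▸ neg_ne_zero.2 one_ne_zero)
  have hu₄0 : u₄ ≠ 0 := right_ne_zero_of_mul (n1 ▸ neg_ne_zero.2 one_ne_zero)
  set b₄ := σ (σ (σ (σ b))) with hb₄
  have hd : d = 0 := by
    have : d * (u₂ * (u₁ + h)) = 0 := by
      linear_combination e5 - u₁ * u₂ * e2 + b₄ * u₂ * u₅ * n1 - b₄ * n2
    refine (mul_eq_zero.1 this).resolve_right (mul_ne_zero hu₂0 fun h0 => hneg ?_)
    rw [hu₁]; linear_combination h0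
  have hb : b₄ = 0 := by
    have : b₄ * (u₄ * (h + u₅)) = 0 := by linear_combination e2 - e3 + hd
    refine (mul_eq_zero.1 this).resolve_right (mul_ne_zero hu₄0 fun h0 => hneg ?_)
    have h6 : σ u₅ = h := by rw [← hu₅, ← hu₄, ← hu₃, ← hu₂, ← hu₁, hσ]
    have h7 := congrArg σ h0
    rw [map_add, h6, map_zero] at h7
    linear_combination h7
  have ha : σ (σ (σ (σ a))) = 0 := by linear_combination e4 + h * u₁ * hd
  exact ⟨by simpa only [map_eq_zero] using ha, by simpa only [hb₄, map_eq_zero] using hb⟩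

/-- The two choices of `(α, β)` are the trinomials
`x^σ + x^{σ³} + ζ x^{σ⁵}` and `ζ x^σ + x^{σ³} + x^{σ⁵}`. Comparing coefficients and eliminating
`a`, `d` leaves linear relations between `b^σ`, `b^{σ³}`, `b^{σ⁵}`; their solvability forces
`h^{2σ} = h^{2σ²}`, and then `b^{σ⁵} = (ζ - 1) b^σ` or `b^σ = (ζ - 1) b^{σ⁵}`, so that
`(ζ - 1)³ = 1`. -/
theorem psiSix_trinomial (h2 : (2 : F) ≠ 0) (ind : IndepSix σ)
    (hσ : ∀ x, σ (σ (σ (σ (σ (σ x))))) = x) (hN : h * σ (σ (σ h)) = -1) {a b c d α β ζ : F}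
    (hζ : ζ ^ 2 + ζ = 1)
    (hαβ : α = 1 ∧ β = ζ ∨ α = ζ ∧ β = 1) (hab : ¬ (a = 0 ∧ b = 0))
    (H : ∀ x, α * σ (a * x + b * psiSix σ h x) + σ (σ (σ (a * x + b * psiSix σ h x))) +
      β * σ (σ (σ (σ (σ (a * x + b * psiSix σ h x))))) = c * x + d * psiSix σ h x) :
    σ h = h ∧ (5 : F) = 0 := by
  obtain ⟨u₁, hu₁⟩ : ∃ y, σ h = y := ⟨_, rfl⟩
  obtain ⟨u₂, hu₂⟩ : ∃ y, σ u₁ = y := ⟨_, rfl⟩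
  obtain ⟨u₃, hu₃⟩ : ∃ y, σ u₂ = y := ⟨_, rfl⟩
  obtain ⟨u₄, hu₄⟩ : ∃ y, σ u₃ = y := ⟨_, rfl⟩
  obtain ⟨u₅, hu₅⟩ : ∃ y, σ u₄ = y := ⟨_, rfl⟩
  have hu₆ : σ u₅ = h := by rw [← hu₅, ← hu₄, ← hu₃, ← hu₂, ← hu₁, hσ]
  obtain ⟨e1, e2, e3, e4, e5⟩ := psiSix_coeff (a := a) (b := b) (c := c) (d := d)
    (k₁ := α) (k₃ := 1) (k₄ := 0) (k₅ := β) ind hσ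
    hu₁ hu₂ hu₃ hu₄ hu₅ (fun x => by linear_combination H x)
  have hneg : σ h ≠ -h := map_ne_neg_of_norm h2 rfl hN
  rw [hu₁, hu₂, hu₃] at hN
  have n1 : u₁ * u₄ = -1 := by rw [← hu₁, ← hu₄, ← map_mul, hN, map_neg, map_one]
  have n2 : u₂ * u₅ = -1 := by rw [← hu₂, ← hu₅, ← map_mul, n1, map_neg, map_one]
  have hζ0 : ζ ≠ 0 := by rintro rfl; simp at hζ
  -- `ζ` lies in the quadratic extension of the fixed field of `σ`
  have hζσ : σ (σ ζ) = ζ := by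
    have h1 : σ ζ ^ 2 + σ ζ = 1 := by rw [← map_pow, ← map_add, hζ, map_one]
    have h3 : (σ ζ - ζ) * (σ ζ + ζ + 1) = 0 := by linear_combination h1 - hζ
    rcases mul_eq_zero.1 h3 with h4 | h4
    · rw [sub_eq_zero.1 h4, sub_eq_zero.1 h4]
    · have h5 : σ ζ = -ζ - 1 := by linear_combination h4
      rw [h5, map_sub, map_neg, h5, map_one]; ring
  have hα : σ (σ α) = α := by rcases hαβ with ⟨rfl, -⟩ | ⟨rfl, -⟩ <;> simp [hζσ]
  have hβ : σ (σ β) = β := by rcases hαβ with ⟨-, rfl⟩ | ⟨-, rfl⟩ <;> simp [hζσ]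
  -- conjugates under `σ²` and `σ⁴`, chosen so that `a` enters through `a^{σ³}` only
  have f1 := congrArg (fun x => σ (σ x)) e1
  have f2 := congrArg (fun x => σ (σ x)) e2
  have f4 := congrArg (fun x => σ (σ x)) e4
  have f5 := congrArg (fun x => σ (σ (σ (σ x)))) e5
  have g2 := congrArg (fun x => σ (σ (σ (σ x)))) e2
  simp only [map_add, map_sub, map_mul, map_neg, hσ, hu₁, hu₂, hu₃, hu₄, hu₅, hu₆,
    hα, hβ, one_mul, zero_mul, add_zero, zero_add] at e1 e2 e3 e4 e5 f1 f2 f4 f5 g2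
  obtain ⟨b₁, hb₁⟩ : ∃ y, σ b = y := ⟨_, rfl⟩
  obtain ⟨b₃, hb₃⟩ : ∃ y, σ (σ b₁) = y := ⟨_, rfl⟩
  obtain ⟨b₅, hb₅⟩ : ∃ y, σ (σ b₃) = y := ⟨_, rfl⟩
  simp only [hb₁, hb₃, hb₅] at e1 e2 e3 e4 e5 f1 f2 f4 f5 g2
  have hbb : σ (σ b₅) = b₁ := by rw [← hb₅, ← hb₃, hσ]
  have hb₁0 : b₁ ≠ 0 := by
    intro h0
    have hb₃0 : b₃ = 0 := by rw [← hb₃, h0, map_zero, map_zero]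
    have hb₅0 : b₅ = 0 := by rw [← hb₅, hb₃0, map_zero, map_zero]
    refine hab ⟨(map_eq_zero σ).1 ((map_eq_zero σ).1 ((map_eq_zero σ).1 ?_)),
      (map_eq_zero σ).1 (hb₁.trans h0)⟩
    simpa only [h0, hb₅0, mul_zero, zero_mul, add_zero, sub_zero] using e3
  -- elimination of `a` and `d`, using that `h h^{σ³} = -1` and its conjugates
  have hI : (α ^ 2 - β) * b₁ + α * b₃ + (u₅ * h * (α * β - 1) - u₅ * u₁) * b₅ = 0 := by
    linear_combination f2 - f1 + α * e3
  have hII : α * β * b₁ + (β ^ 2 * (u₅ * h) - α * (u₅ * h) - α * (u₄ * h)) * b₅ = 0 := by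
    linear_combination β * e3 - f5 - u₄ * h * g2 - b₁ * h * u₃ * n1 + b₁ * hN
  have hIII : h * b₅ + β * b₁ * u₁ + α * b₃ * u₂ + b₅ * u₁ = 0 := by
    linear_combination h * f4 + (β * b₁ * u₁ + σ (σ d) * u₂) * hN + u₂ * f2 + b₅ * u₁ * n2
  have hαβζ : α * β = ζ := by rcases hαβ with ⟨rfl, rfl⟩ | ⟨rfl, rfl⟩ <;> simp
  have hP : ((α ^ 2 - β) * u₂ - β * u₁) * b₁ = ζ * h * b₅ := by
    linear_combination u₂ * hI - hIII + (u₁ - h * (α * β - 1)) * b₅ * n2 + h * b₅ * hαβζ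
  have hQ : ζ * u₁ * u₂ * b₁ + h * (α * u₂ + (α - β ^ 2) * u₁) * b₅ = 0 := by
    linear_combination u₁ * u₂ * hII - u₁ * u₂ * b₁ * hαβζ +
      α * h * u₂ * b₅ * n1 + (α - β ^ 2) * h * u₁ * b₅ * n2
  -- the last two relations, linear in `b^σ` and `b^{σ⁵}`, have vanishing determinant
  have hsq : (u₁ - u₂) * (u₁ + u₂) = 0 := by
    have : b₁ * (ζ ^ 2 * ((u₁ - u₂) * (u₁ + u₂))) = 0 := by
      rcases hαβ with ⟨rfl, rfl⟩ | ⟨rfl, rfl⟩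
      · linear_combination -β * hQ - (u₂ + (1 - β ^ 2) * u₁) * hP +
          b₁ * (β * u₁ ^ 2 - u₂ ^ 2 + (β - 1) * u₁ * u₂) * hζ
      · linear_combination α * hQ + (α * u₂ + (α - 1) * u₁) * hP +
          b₁ * (u₁ ^ 2 - α * u₂ ^ 2 - (α - 1) * u₁ * u₂) * hζ
    exact (mul_eq_zero.1 ((mul_eq_zero.1 this).resolve_left hb₁0)).resolve_left
      (pow_ne_zero 2 hζ0)
  have hu : u₁ = h := by
    rcases mul_eq_zero.1 hsq with h0 | h0
    · refine σ.injective ?_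
      rw [hu₁, hu₂]; linear_combination -h0
    · refine (hneg (σ.injective ?_)).elim
      rw [map_neg, hu₁, hu₂]; linear_combination h0
  have hh : u₂ = h := by rw [← hu₂, hu, hu₁, hu]
  have hh0 : h ≠ 0 := left_ne_zero_of_mul (hN ▸ neg_ne_zero.2 one_ne_zero)
  refine ⟨hu₁.trans hu, ?_⟩
  rw [hu, hh] at hP
  -- `b^{σ⁵}` and `b^σ` differ by the factor `ζ - 1`, which is fixed by `σ²`
  have hcube : (ζ - 1) ^ 3 = 1 := by
    rcases hαβ with ⟨rfl, rfl⟩ | ⟨rfl, rfl⟩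
    · have hκ : b₅ = (β - 1) * b₁ := by
        refine mul_left_cancel₀ (mul_ne_zero hh0 hζ0) ?_
        linear_combination -hP - h * b₁ * hζ
      have hκ₁ : b₁ = (β - 1) * b₃ := by
        have := congrArg (fun x => σ (σ x)) hκ
        simpa only [map_mul, map_sub, map_one, hζσ, hbb, hb₃] using this
      have hκ₃ : b₃ = (β - 1) * b₅ := by
        have := congrArg (fun x => σ (σ x)) hκ₁
        simpa only [map_mul, map_sub, map_one, hζσ, hb₃, hb₅] using this
      refine mul_right_cancel₀ hb₁0 ?_
      linear_combination -hκ₁ - (β - 1) * hκ₃ - (β - 1) ^ 2 * hκ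
    · have hκ : b₁ = (α - 1) * b₅ := by
        refine mul_left_cancel₀ hh0 ?_
        linear_combination -α * hP + ((α - 1) * h * b₁ - h * b₅) * hζ
      have hκ₃ : b₃ = (α - 1) * b₁ := by
        have := congrArg (fun x => σ (σ x)) hκ
        simpa only [map_mul, map_sub, map_one, hζσ, hbb, hb₃] using this
      have hκ₅ : b₅ = (α - 1) * b₃ := by
        have := congrArg (fun x => σ (σ x)) hκ₃
        simpa only [map_mul, map_sub, map_one, hζσ, hb₃, hb₅] using this
      refine mul_right_cancel₀ hb₁0 ?_
      linear_combination -hκ - (α - 1) * hκ₅ - (α - 1) ^ 2 * hκ₃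
  have h43 : 4 * ζ = 3 := by
    refine mul_left_cancel₀ h2 ?_
    linear_combination hcube - (ζ - 4) * hζ
  linear_combination 16 * hζ - (4 * ζ + 7) * h43

/-- When `h` is fixed by `σ`, the coefficients of `ψ` are `1, 1, -1, 1`. -/
theorem psiSix_of_sq_eq_neg_one (h₁ : σ h = h) (hh : h ^ 2 = -1) (x : F) :
    psiSix σ h x = σ x + σ (σ x) - σ (σ (σ (σ x))) + σ (σ (σ (σ (σ x)))) := by
  rw [psiSix, h₁, h₁]
  linear_combination (σ (σ (σ (σ x))) - σ (σ (σ (σ (σ x))))) * hh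

/-- In characteristic five with `h` fixed by `σ`, all coefficients lie in the prime field, and
`x + ψ(x)` has the inverse `-2x + x^σ + x^{σ³} + 2x^{σ⁵}`. -/
theorem injective_add_psiSix (hσ : ∀ x, σ (σ (σ (σ (σ (σ x))))) = x) (h5 : (5 : F) = 0)
    (h₁ : σ h = h) (hh : h ^ 2 = -1) :
    Function.Injective fun x => 1 * x + 1 * psiSix σ h x := by
  refine Function.LeftInverse.injective
    (g := fun z => -2 * z + σ z + σ (σ (σ z)) + 2 * σ (σ (σ (σ (σ z))))) fun x => ?_
  simp only [psiSix_of_sq_eq_neg_one h₁ hh, map_add, map_sub, map_mul, map_one, hσ]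
  linear_combination σ (σ (σ (σ x))) * h5

/-- In characteristic five with `h` fixed by `σ`, the map `-x + ψ(x)` has the inverse
`2x + 2x^σ + x^{σ³} + x^{σ⁵}`. -/
theorem injective_neg_add_psiSix (hσ : ∀ x, σ (σ (σ (σ (σ (σ x))))) = x) (h5 : (5 : F) = 0)
    (h₁ : σ h = h) (hh : h ^ 2 = -1) :
    Function.Injective fun x => -1 * x + 1 * psiSix σ h x := by
  refine Function.LeftInverse.injective
    (g := fun z => 2 * z + 2 * σ z + σ (σ (σ z)) + σ (σ (σ (σ (σ z))))) fun x => ?_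
  simp only [psiSix_of_sq_eq_neg_one h₁ hh, map_add, map_sub, map_mul, map_neg, map_one, hσ]
  linear_combination σ (σ x) * h5

theorem trinomial_comp_add_psiSix (hσ : ∀ x, σ (σ (σ (σ (σ (σ x))))) = x) (h5 : (5 : F) = 0)
    (h₁ : σ h = h) (hh : h ^ 2 = -1) (x : F) :
    σ (1 * x + 1 * psiSix σ h x) + σ (σ (σ (1 * x + 1 * psiSix σ h x))) +
      2 * σ (σ (σ (σ (σ (1 * x + 1 * psiSix σ h x))))) = 3 * x + 2 * psiSix σ h x := by
  simp only [psiSix_of_sq_eq_neg_one h₁ hh, map_add, map_sub, map_mul, map_one, hσ]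
  linear_combination σ (σ (σ (σ x))) * h5

theorem trinomial_comp_neg_add_psiSix (hσ : ∀ x, σ (σ (σ (σ (σ (σ x))))) = x)
    (h5 : (5 : F) = 0) (h₁ : σ h = h) (hh : h ^ 2 = -1) (x : F) :
    2 * σ (-1 * x + 1 * psiSix σ h x) + σ (σ (σ (-1 * x + 1 * psiSix σ h x))) +
      σ (σ (σ (σ (σ (-1 * x + 1 * psiSix σ h x))))) = 3 * x + 3 * psiSix σ h x := by
  simp only [psiSix_of_sq_eq_neg_one h₁ hh, map_add, map_sub, map_mul, map_neg, map_one, hσ]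
  linear_combination (σ (σ (σ (σ x))) - σ x - σ (σ (σ (σ (σ x))))) * h5

end Six

/-! ### The case `t = 4`, in terms of a field endomorphism of order eight -/

/-- The map of `ψ_{h,4,s}` in terms of `σ = (x ↦ x^{q^s})`; the last coefficient
`h^{1-σ⁷}` is `-h h^{σ³}`, since `h^{σ³} h^{σ⁷} = -1`. -/
def psiEight (σ : F →+* F) (h x : F) : F :=
  σ x + σ (σ (σ x)) + h * σ h * σ (σ (σ (σ (σ x)))) -
    h * σ (σ (σ h)) * σ (σ (σ (σ (σ (σ (σ x))))))

/-- The powers `1, σ, …, σ⁷` are linearly independent over `F` as maps `F → F`. -/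
def IndepEight (σ : F →+* F) : Prop :=
  ∀ k₀ k₁ k₂ k₃ k₄ k₅ k₆ k₇ : F, (∀ x, k₀ * x + k₁ * σ x + k₂ * σ (σ x) + k₃ * σ (σ (σ x)) +
    k₄ * σ (σ (σ (σ x))) + k₅ * σ (σ (σ (σ (σ x)))) + k₆ * σ (σ (σ (σ (σ (σ x))))) +
    k₇ * σ (σ (σ (σ (σ (σ (σ x)))))) = 0) →
    k₀ = 0 ∧ k₁ = 0 ∧ k₂ = 0 ∧ k₃ = 0 ∧ k₄ = 0 ∧ k₅ = 0 ∧ k₆ = 0 ∧ k₇ = 0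

section Eight

variable {σ : F →+* F} {h : F}

/-- The left idealizer of `⟨x, ψ⟩` consists of scalars. -/
theorem psiEight_idealizer (ind : IndepEight σ) {b : F}
    (hb : ∀ γ : F, ∃ e g : F, ∀ x, b * psiEight σ h (γ * x) = e * x + g * psiEight σ h x) :
    b = 0 := by
  by_contra hb0
  have key : ∀ γ, σ γ = σ (σ (σ γ)) := by
    intro γ
    obtain ⟨e, g, H⟩ := hb γ
    obtain ⟨-, h1, -, h3, -⟩ := ind (-e) (b * σ γ - g) 0 (b * σ (σ (σ γ)) - g) 0
      (b * (h * σ h * σ (σ (σ (σ (σ γ))))) - g * (h * σ h)) 0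
      (g * (h * σ (σ (σ h))) - b * (h * σ (σ (σ h)) * σ (σ (σ (σ (σ (σ (σ γ)))))))) (fun x => by
        have := H x
        simp only [psiEight, map_mul] at this
        linear_combination this)
    exact mul_left_cancel₀ hb0 (by linear_combination h1 - h3)
  have := (ind 0 1 0 (-1) 0 0 0 0 (fun x => by linear_combination key x)).2.1
  exact one_ne_zero this

/-- Comparison of coefficients in `f ∘ (a x + b ψ(x)) = c x + d ψ(x)` for
`f = k₁ x^σ + k₅ x^{σ⁵} + k₇ x^{σ⁷}`. Both `f` and `ψ` involve odd powers of `σ` only, so that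
the even powers come from `b` alone, and the odd ones force `d = 0`, as `f` has no term in
`x^{σ³}`. -/
theorem psiEight_coeff (ind : IndepEight σ)
    (hσ : ∀ x, σ (σ (σ (σ (σ (σ (σ (σ x))))))) = x)
    {u₁ u₂ u₃ u₄ u₅ u₆ u₇ : F} (h₁ : σ h = u₁) (h₂ : σ u₁ = u₂) (h₃ : σ u₂ = u₃) (h₄ : σ u₃ = u₄)
    (h₅ : σ u₄ = u₅) (h₆ : σ u₅ = u₆) (h₇ : σ u₆ = u₇) {a b c d k₁ k₅ k₇ : F}
    (H : ∀ x, k₁ * σ (a * x + b * psiEight σ h x) +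
      k₅ * σ (σ (σ (σ (σ (a * x + b * psiEight σ h x))))) +
      k₇ * σ (σ (σ (σ (σ (σ (σ (a * x + b * psiEight σ h x))))))) = c * x + d * psiEight σ h x) :
    k₁ * σ a = 0 ∧ k₅ * σ (σ (σ (σ (σ a)))) = 0 ∧
    k₇ * σ (σ (σ (σ (σ (σ (σ a)))))) = 0 ∧
    k₁ * σ b + k₅ * σ (σ (σ (σ (σ b)))) * (u₅ * u₆) + k₇ * σ (σ (σ (σ (σ (σ (σ b)))))) = 0 ∧
    k₁ * σ b - k₅ * σ (σ (σ (σ (σ b)))) * (u₅ * h) +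
      k₇ * σ (σ (σ (σ (σ (σ (σ b)))))) * (u₇ * h) = 0 ∧
    k₁ * σ b * (u₁ * u₂) + k₅ * σ (σ (σ (σ (σ b)))) -
      k₇ * σ (σ (σ (σ (σ (σ (σ b)))))) * (u₇ * u₂) = 0 := by
  have h₈ : σ u₇ = h := by rw [← h₇, ← h₆, ← h₅, ← h₄, ← h₃, ← h₂, ← h₁, hσ]
  obtain ⟨-, e1, e2, e3, e4, e5, e6, e7⟩ := ind
    (k₅ * σ (σ (σ (σ (σ b)))) + k₇ * σ (σ (σ (σ (σ (σ (σ b)))))) - k₁ * σ b * (u₁ * u₄) - c)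
    (k₁ * σ a - d)
    (k₁ * σ b + k₅ * σ (σ (σ (σ (σ b)))) * (u₅ * u₆) + k₇ * σ (σ (σ (σ (σ (σ (σ b)))))))
    (-d)
    (k₁ * σ b - k₅ * σ (σ (σ (σ (σ b)))) * (u₅ * h) +
      k₇ * σ (σ (σ (σ (σ (σ (σ b)))))) * (u₇ * h))
    (k₅ * σ (σ (σ (σ (σ a)))) - d * (h * u₁))
    (k₁ * σ b * (u₁ * u₂) + k₅ * σ (σ (σ (σ (σ b)))) -
      k₇ * σ (σ (σ (σ (σ (σ (σ b)))))) * (u₇ * u₂))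
    (k₇ * σ (σ (σ (σ (σ (σ (σ a)))))) + d * (h * u₃)) (fun x => by
        have := H x
        simp only [psiEight, map_add, map_sub, map_mul, hσ, h₁, h₂, h₃, h₄, h₅, h₆, h₇, h₈] at this
        linear_combination this)
  exact ⟨by linear_combination e1 - e3, by linear_combination e5 - h * u₁ * e3,
    by linear_combination e7 + h * u₃ * e3, e2, e4, e6⟩

theorem psiEight_gabidulin (ind : IndepEight σ)
    (hσ : ∀ x, σ (σ (σ (σ (σ (σ (σ (σ x))))))) = x) {a b c d : F}
    (H : ∀ x, σ (a * x + b * psiEight σ h x) = c * x + d * psiEight σ h x) : a = 0 ∧ b = 0 := by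
  obtain ⟨e1, -, -, e2, -, -⟩ := psiEight_coeff (a := a) (b := b) (c := c) (d := d) (k₁ := 1)
    (k₅ := 0) (k₇ := 0) ind hσ rfl rfl rfl rfl rfl rfl rfl (fun x => by linear_combination H x)
  have ha : σ a = 0 := by linear_combination e1
  have hb : σ b = 0 := by linear_combination e2
  exact ⟨(map_eq_zero σ).1 ha, (map_eq_zero σ).1 hb⟩

theorem psiEight_twisted (h2 : (2 : F) ≠ 0) (ind : IndepEight σ)
    (hσ : ∀ x, σ (σ (σ (σ (σ (σ (σ (σ x))))))) = x) {a b c d η : F}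
    (H : ∀ x, η * σ (a * x + b * psiEight σ h x) +
      σ (σ (σ (σ (σ (σ (σ (a * x + b * psiEight σ h x))))))) = c * x + d * psiEight σ h x) :
    a = 0 ∧ b = 0 := by
  obtain ⟨u₁, hu₁⟩ : ∃ y, σ h = y := ⟨_, rfl⟩
  obtain ⟨u₂, hu₂⟩ : ∃ y, σ u₁ = y := ⟨_, rfl⟩
  obtain ⟨u₃, hu₃⟩ : ∃ y, σ u₂ = y := ⟨_, rfl⟩
  obtain ⟨u₄, hu₄⟩ : ∃ y, σ u₃ = y := ⟨_, rfl⟩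
  obtain ⟨u₅, hu₅⟩ : ∃ y, σ u₄ = y := ⟨_, rfl⟩
  obtain ⟨u₆, hu₆⟩ : ∃ y, σ u₅ = y := ⟨_, rfl⟩
  obtain ⟨u₇, hu₇⟩ : ∃ y, σ u₆ = y := ⟨_, rfl⟩
  obtain ⟨-, -, e7, e2, e4, e6⟩ := psiEight_coeff (a := a) (b := b) (c := c) (d := d) (k₁ := η)
    (k₅ := 0) (k₇ := 1) ind hσ hu₁ hu₂ hu₃ hu₄ hu₅ hu₆ hu₇
    (fun x => by linear_combination H x)
  have hu₈ : σ u₇ = h := by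
    rw [← hu₇, ← hu₆, ← hu₅, ← hu₄, ← hu₃, ← hu₂, ← hu₁, hσ]
  have ha : σ (σ (σ (σ (σ (σ (σ a)))))) = 0 := by linear_combination e7
  have hb : σ (σ (σ (σ (σ (σ (σ b)))))) = 0 := by
    by_contra hb
    set B := σ (σ (σ (σ (σ (σ (σ b))))))
    have h70 : u₇ * h = 1 := mul_left_cancel₀ hb (by linear_combination e4 - e2)
    have h01 : h * u₁ = 1 := by
      have := congrArg σ h70
      simpa only [map_mul, map_one, hu₈, hu₁] using this
    have h12 : u₁ * u₂ = 1 := by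
      have := congrArg σ h01
      simpa only [map_mul, map_one, hu₂, hu₁] using this
    have h72 : -(u₇ * u₂) = 1 :=
      mul_left_cancel₀ hb (by rw [mul_one]; linear_combination e6 - u₁ * u₂ * e2 + B * h12)
    -- `h^{σ⁷} = h^σ = h⁻¹` and `h^{σ²} = h`, so the last relation reads `-1 = 1`
    exact h2 (by linear_combination -h72 - u₇ * h * h12 + u₇ * u₂ * h01 - h70)
  exact ⟨by simpa only [map_eq_zero] using ha, by simpa only [map_eq_zero] using hb⟩

theorem psiEight_dickson (h2 : (2 : F) ≠ 0) (ind : IndepEight σ)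
    (hσ : ∀ x, σ (σ (σ (σ (σ (σ (σ (σ x))))))) = x) (hN : h * σ (σ (σ (σ h))) = -1)
    {a b c d δ : F}
    (H : ∀ x, δ * σ (a * x + b * psiEight σ h x) +
      σ (σ (σ (σ (σ (a * x + b * psiEight σ h x))))) = c * x + d * psiEight σ h x) :
    a = 0 ∧ b = 0 := by
  obtain ⟨-, e5, -, e2, e4, -⟩ := psiEight_coeff (a := a) (b := b) (c := c) (d := d) (k₁ := δ)
    (k₅ := 1) (k₇ := 0) ind hσ rfl rfl rfl rfl rfl rfl rfl
    (fun x => by linear_combination H x)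
  have ha : σ (σ (σ (σ (σ a)))) = 0 := by linear_combination e5
  have hh0 : h ≠ 0 := left_ne_zero_of_mul (hN ▸ neg_ne_zero.2 one_ne_zero)
  have hb : σ (σ (σ (σ (σ b)))) = 0 := by
    by_contra hb
    have h5 : σ (σ (σ (σ (σ h)))) ≠ 0 := by simpa only [ne_eq, map_eq_zero] using hh0
    have h60 : σ (σ (σ (σ (σ (σ h))))) = -h :=
      mul_left_cancel₀ (mul_ne_zero hb h5) (by linear_combination e2 - e4)
    have h20 : σ (σ h) = -h := by
      have := congrArg (fun x => σ (σ x)) h60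
      simp only [hσ, map_neg] at this
      linear_combination this
    -- hence `h² = -1`, so that `h^σ = ±h` and `h^{σ²} = h`
    have hsq : h ^ 2 = -1 := by
      simp only [h20, map_neg, neg_neg] at hN
      linear_combination hN
    have hsq' : (σ h) ^ 2 = -1 := by rw [← map_pow, hsq, map_neg, map_one]
    have h22 : σ (σ h) = h := by
      have : (σ h - h) * (σ h + h) = 0 := by linear_combination hsq' - hsq
      rcases mul_eq_zero.1 this with h0 | h0
      · rw [sub_eq_zero.1 h0, sub_eq_zero.1 h0]
      · rw [eq_neg_of_add_eq_zero_left h0, map_neg, eq_neg_of_add_eq_zero_left h0, neg_neg]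
    exact mul_ne_zero h2 hh0 (by linear_combination h20 - h22)
  exact ⟨by simpa only [map_eq_zero] using ha, by simpa only [map_eq_zero] using hb⟩

end Eight

/-! ### Translation between `q`-polynomials and powers of `x ↦ x^{q^s}` -/

theorem pow_pow_mul_eq_iterate {q s : ℕ} {σ : F →+* F}
    (hσ : ∀ x, σ x = x ^ q ^ s) (k : ℕ) (x : F) : x ^ q ^ (s * k) = σ^[k] x := by
  induction k with
  | zero => simp
  | succ k ih => rw [Function.iterate_succ_apply', ← ih, hσ, ← pow_mul, ← pow_add, Nat.mul_succ]

/-- For `s` prime to `6`, the code `Z_{6,ζ}` is spanned by `x` and a trinomial in `x ↦ x^{q^s}`,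
in which the first and last coefficients are exchanged when `s ≡ -1` modulo `6`. -/
theorem trinomial_cases {s : ℕ} (hs : Nat.Coprime (2 * 3) s) (ζ : F) :
    ∃ α β : F, (α = 1 ∧ β = ζ ∨ α = ζ ∧ β = 1) ∧
      ((mono (2 * 3) 1 + mono (2 * 3) 3 + ζ • mono (2 * 3) 5 : QPoly (2 * 3) F) =
        α • mono (2 * 3) s + mono (2 * 3) (s * 3) + β • mono (2 * 3) (s * 5)) := by
  have h2 : ¬ 2 ∣ s := fun h =>
    absurd (Nat.dvd_gcd (show 2 ∣ 2 * 3 by norm_num) h) (by rw [hs.gcd_eq_one]; decide)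
  have h3 : ¬ 3 ∣ s := fun h =>
    absurd (Nat.dvd_gcd (show 3 ∣ 2 * 3 by norm_num) h) (by rw [hs.gcd_eq_one]; decide)
  have hmod : s % 6 = 1 ∨ s % 6 = 5 := by omega
  have hm3 : (mono (2 * 3) 3 : QPoly (2 * 3) F) = mono (2 * 3) (s * 3) :=
    mono_congr (by omega)
  rcases hmod with hm | hm
  · refine ⟨1, ζ, Or.inl ⟨rfl, rfl⟩, ?_⟩
    rw [hm3, mono_congr (F := F) (show 1 % (2 * 3) = s % (2 * 3) by omega),
      mono_congr (F := F) (show 5 % (2 * 3) = s * 5 % (2 * 3) by omega), one_smul]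
  · refine ⟨ζ, 1, Or.inr ⟨rfl, rfl⟩, ?_⟩
    rw [hm3, mono_congr (F := F) (show 5 % (2 * 3) = s % (2 * 3) by omega),
      mono_congr (F := F) (show 1 % (2 * 3) = s * 5 % (2 * 3) by omega), one_smul]
    abel

/-- `x^{q^{s+t}}` is `x^{σ^{t+1}}`, since `s` is odd. -/
theorem mono_add_half {s t : ℕ} (hs : Nat.Coprime (2 * t) s) :
    (mono (2 * t) (s + 2 * t / 2) : QPoly (2 * t) F) = mono (2 * t) (s * (t + 1)) := by
  have h2 : ¬ 2 ∣ s := fun h =>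
    absurd (Nat.dvd_gcd (Dvd.intro t rfl) h) (by rw [hs.gcd_eq_one]; decide)
  obtain ⟨k, rfl⟩ : ∃ k, s = 2 * k + 1 := ⟨s / 2, by omega⟩
  refine mono_congr ?_
  rw [Nat.mul_div_cancel_left t two_pos,
    show (2 * k + 1) * (t + 1) = 2 * k + 1 + t + 2 * t * k by ring, Nat.add_mul_mod_self_left]

section Finite

variable [Finite F] {q n s : ℕ}

theorem pow_pow_congr (hn : 0 < n) (hF : Nat.card F = q ^ n) {i j : ℕ} (hij : i % n = j % n)
    (x : F) : x ^ q ^ i = x ^ q ^ j := by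
  rw [← eval_mono q hn hF, mono_congr hij, eval_mono q hn hF]

theorem eval_mono_mul (hn : 0 < n) (hF : Nat.card F = q ^ n) {σ : F →+* F}
    (hσ : ∀ x, σ x = x ^ q ^ s) (k : ℕ) (x : F) : eval q (mono n (s * k)) x = σ^[k] x := by
  rw [eval_mono q hn hF, pow_pow_mul_eq_iterate hσ]

theorem iterate_card (hn : 0 < n) (hF : Nat.card F = q ^ n) {σ : F →+* F}
    (hσ : ∀ x, σ x = x ^ q ^ s) (x : F) : σ^[n] x = x := by
  rw [← pow_pow_mul_eq_iterate hσ,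
    pow_pow_congr hn hF (j := 0) (by rw [Nat.mul_mod_left, Nat.zero_mod])]
  simp

theorem two_ne_zero_of_odd (hn : 0 < n) (hF : Nat.card F = q ^ n) (hodd : Odd q) :
    (2 : F) ≠ 0 := by
  intro h2
  obtain ⟨p, e, hp, hchar, rfl⟩ := exists_char_pow hn hF
  have h2' : ((2 : ℕ) : F) = 0 := by exact_mod_cast h2
  have hp2 : p = 2 :=
    (Nat.prime_dvd_prime_iff_eq hp Nat.prime_two).1 ((CharP.cast_eq_zero_iff F p 2).1 h2')
  subst hp2
  rcases e with - | e
  · exact absurd (one_lt_of_card hn hF) (by simp)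
  · exact (Nat.not_odd_iff_even.2 ((Nat.even_pow.2 ⟨even_two, e.succ_ne_zero⟩))) hodd

theorem five_eq_zero_iff (hn : 0 < n) (hF : Nat.card F = q ^ n) :
    (5 : F) = 0 ↔ ∃ e : ℕ, q = 5 ^ e := by
  obtain ⟨p, e, hp, hchar, hq⟩ := exists_char_pow hn hF
  have h5 : (5 : F) = 0 ↔ p ∣ 5 := by
    rw [← CharP.cast_eq_zero_iff F p 5]; norm_cast
  rw [h5]
  constructor
  · intro h
    rw [(Nat.prime_dvd_prime_iff_eq hp Nat.prime_five).1 h] at hq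
    exact ⟨e, hq⟩
  · rintro ⟨k, hk⟩
    have he : e ≠ 0 := by
      rintro rfl
      exact absurd (one_lt_of_card hn hF) (by simp [hq])
    exact hp.dvd_of_dvd_pow (hk ▸ hq ▸ dvd_pow_self p he : p ∣ 5 ^ k)

/-- Since `s` is odd, the norm over the subfield with `q^t` elements is `x^{1 + σ^t}`. -/
theorem fieldNorm_two {t : ℕ} (ht : 0 < t) (hF : Nat.card F = q ^ (2 * t))
    (hs : Nat.Coprime (2 * t) s) {σ : F →+* F} (hσ : ∀ x, σ x = x ^ q ^ s) (x : F) :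
    fieldNorm q t 2 x = x * σ^[t] x := by
  have h2 : ¬ 2 ∣ s := fun h =>
    absurd (Nat.dvd_gcd (Dvd.intro t rfl) h) (by rw [hs.gcd_eq_one]; decide)
  obtain ⟨k, rfl⟩ : ∃ k, s = 2 * k + 1 := ⟨s / 2, by omega⟩
  rw [← pow_pow_mul_eq_iterate hσ, pow_pow_congr (by omega) hF (j := t)]
  · simp [fieldNorm, Finset.prod_range_succ]
  · rw [show (2 * k + 1) * t = t + 2 * t * k by ring, Nat.add_mul_mod_self_left]

theorem indepSix (hF : Nat.card F = q ^ (2 * 3)) (hs : Nat.Coprime (2 * 3) s) {σ : F →+* F}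
    (hσ : ∀ x, σ x = x ^ q ^ s) : IndepSix σ := by
  intro k₀ k₁ k₂ k₃ k₄ k₅ H
  have hli := Fintype.linearIndependent_iff.1
    (linearIndependent_pow (n := 6) (by norm_num) hF hs) ![k₀, k₁, k₂, k₃, k₄, k₅] (by
      funext x
      simp only [Finset.sum_apply, Pi.smul_apply, smul_eq_mul, pow_pow_mul_eq_iterate hσ,
        Fin.sum_univ_six]
      exact H x)
  exact ⟨hli 0, hli 1, hli 2, hli 3, hli 4, hli 5⟩

theorem indepEight (hF : Nat.card F = q ^ (2 * 4)) (hs : Nat.Coprime (2 * 4) s) {σ : F →+* F}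
    (hσ : ∀ x, σ x = x ^ q ^ s) : IndepEight σ := by
  intro k₀ k₁ k₂ k₃ k₄ k₅ k₆ k₇ H
  have hli := Fintype.linearIndependent_iff.1
    (linearIndependent_pow (n := 8) (by norm_num) hF hs) ![k₀, k₁, k₂, k₃, k₄, k₅, k₆, k₇] (by
      funext x
      simp only [Finset.sum_apply, Pi.smul_apply, smul_eq_mul, pow_pow_mul_eq_iterate hσ,
        Fin.sum_univ_eight]
      exact H x)
  exact ⟨hli 0, hli 1, hli 2, hli 3, hli 4, hli 5, hli 6, hli 7⟩

theorem eval_psi_three (hF : Nat.card F = q ^ (2 * 3)) {σ : F →+* F}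
    (hσ : ∀ x, σ x = x ^ q ^ s) {h : F} (hN : h * σ (σ (σ h)) = -1) (x : F) :
    eval q (psi q 3 s h) x = psiSix σ h x := by
  have hmono := eval_mono_mul (F := F) (n := 2 * 3) (by norm_num) hF hσ
  have hcoef : h / h ^ q ^ (s * (2 * 3 - 1)) = -(h * σ (σ h)) := by
    have h2 := congrArg (fun y => σ (σ y)) hN
    simp only [map_mul, map_neg, map_one] at h2
    have h5 : σ (σ (σ (σ (σ h)))) ≠ 0 :=
      right_ne_zero_of_mul (h2 ▸ neg_ne_zero.2 one_ne_zero)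
    rw [pow_pow_mul_eq_iterate hσ]
    refine (div_eq_iff h5).2 ?_
    linear_combination h * h2
  have h1 := hmono 1 x
  rw [mul_one] at h1
  rw [psi, hcoef, pow_add, pow_one, ← hσ]
  simp only [eval_add, eval_smul, hmono, h1]
  change σ x + σ (σ x) + h * σ h * σ (σ (σ (σ x))) +
    -(h * σ (σ h)) * σ (σ (σ (σ (σ x)))) = psiSix σ h x
  rw [psiSix]; ring

theorem eval_psi_four (hF : Nat.card F = q ^ (2 * 4)) {σ : F →+* F}
    (hσ : ∀ x, σ x = x ^ q ^ s) {h : F} (hN : h * σ (σ (σ (σ h))) = -1) (x : F) :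
    eval q (psi q 4 s h) x = psiEight σ h x := by
  have hmono := eval_mono_mul (F := F) (n := 2 * 4) (by norm_num) hF hσ
  have hcoef : h / h ^ q ^ (s * (2 * 4 - 1)) = -(h * σ (σ (σ h))) := by
    have h3 := congrArg (fun y => σ (σ (σ y))) hN
    simp only [map_mul, map_neg, map_one] at h3
    have h7 : σ (σ (σ (σ (σ (σ (σ h)))))) ≠ 0 :=
      right_ne_zero_of_mul (h3 ▸ neg_ne_zero.2 one_ne_zero)
    rw [pow_pow_mul_eq_iterate hσ]
    refine (div_eq_iff h7).2 ?_
    linear_combination h * h3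
  have h1 := hmono 1 x
  rw [mul_one] at h1
  rw [psi, hcoef, pow_add, pow_one, ← hσ]
  simp only [eval_add, eval_smul, hmono, h1]
  change σ x + σ (σ (σ x)) + h * σ h * σ (σ (σ (σ (σ x)))) +
    -(h * σ (σ (σ h))) * σ (σ (σ (σ (σ (σ (σ x)))))) = psiEight σ h x
  rw [psiEight]; ring

/-- The maps `x ↦ x^q` and `x ↦ x^{q^s}` have the same fixed points. -/
theorem pow_eq_self_iff (hn : 1 < n) (hF : Nat.card F = q ^ n) (hs : Nat.Coprime n s)
    {σ : F →+* F} (hσ : ∀ x, σ x = x ^ q ^ s) (x : F) : x ^ q = x ↔ σ x = x := by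
  constructor
  · intro h
    rw [hσ]
    clear hσ hs
    induction s with
    | zero => simp
    | succ s ih => rw [pow_succ, pow_mul, ih, h]
  · intro h
    obtain ⟨k, -, hk⟩ := Nat.exists_mul_mod_eq_one_of_coprime hs.symm hn
    have h1 := pow_pow_congr (zero_lt_one.trans hn) hF (hk.trans (Nat.mod_eq_of_lt hn).symm) x
    rw [pow_pow_mul_eq_iterate hσ, Function.iterate_fixed h, pow_one] at h1
    exact h1.symm

end Finite

/-! ### The inequivalences and the equivalence -/

section Finite

variable [Finite F] {q s : ℕ}

theorem exists_comp_psiSix (hF : Nat.card F = q ^ (2 * 3)) (hs : Nat.Coprime (2 * 3) s)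
    {σ : F →+* F} (hσ : ∀ x, σ x = x ^ q ^ s) {h : F} (hN : h * σ (σ (σ h)) = -1)
    {f : QPoly (2 * 3) F} (H : CodeEquiv q (code f) (codeC q 3 s h)) :
    ∃ (ρ : F ≃+* F) (a b c d : F), ¬ (a = 0 ∧ b = 0) ∧
      ∀ x, eval q (twist ρ f) (a * x + b * psiSix σ h x) = c * x + d * psiSix σ h x := by
  have hψ := eval_psi_three hF hσ hN
  obtain ⟨ρ, a, b, c, d, hab, H'⟩ := CodeEquiv.exists_comp (by norm_num) hF (fun b hb =>
    psiSix_idealizer (h := h) (indepSix hF hs hσ) (by simpa only [hψ] using hb)) H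
  exact ⟨ρ, a, b, c, d, hab, by simpa only [hψ] using H'⟩

theorem exists_comp_psiEight (hF : Nat.card F = q ^ (2 * 4)) (hs : Nat.Coprime (2 * 4) s)
    {σ : F →+* F} (hσ : ∀ x, σ x = x ^ q ^ s) {h : F} (hN : h * σ (σ (σ (σ h))) = -1)
    {f : QPoly (2 * 4) F} (H : CodeEquiv q (code f) (codeC q 4 s h)) :
    ∃ (ρ : F ≃+* F) (a b c d : F), ¬ (a = 0 ∧ b = 0) ∧
      ∀ x, eval q (twist ρ f) (a * x + b * psiEight σ h x) = c * x + d * psiEight σ h x := by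
  have hψ := eval_psi_four hF hσ hN
  obtain ⟨ρ, a, b, c, d, hab, H'⟩ := CodeEquiv.exists_comp (by norm_num) hF (fun b hb =>
    psiEight_idealizer (h := h) (indepEight hF hs hσ) (by simpa only [hψ] using hb)) H
  exact ⟨ρ, a, b, c, d, hab, by simpa only [hψ] using H'⟩

theorem not_codeEquiv_three (hodd : Odd q) (hF : Nat.card F = q ^ (2 * 3))
    (hs : Nat.Coprime (2 * 3) s) {h : F} (hh : fieldNorm q 3 2 h = -1) :
    (∀ η : F, ¬ CodeEquiv q (codeH (2 * 3) s η) (codeC q 3 s h)) ∧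
      ¬ CodeEquiv q (codeG (2 * 3) s) (codeC q 3 s h) ∧
      ∀ δ : F, ¬ CodeEquiv q (codeK (2 * 3) s δ) (codeC q 3 s h) := by
  have hn : 0 < 2 * 3 := by norm_num
  obtain ⟨σ, hσ⟩ := exists_ringHom_pow hn hF s
  have hN : h * σ (σ (σ h)) = -1 := by
    rw [← hh, fieldNorm_two (by norm_num) hF hs hσ]; rfl
  have h2 := two_ne_zero_of_odd hn hF hodd
  have ind := indepSix hF hs hσ
  have hσ6 : ∀ x, σ (σ (σ (σ (σ (σ x))))) = x := iterate_card hn hF hσ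
  have hmono := eval_mono_mul (F := F) hn hF hσ
  have hmono1 : ∀ x : F, eval q (mono (2 * 3) s) x = σ x := fun x => by
    rw [eval_mono q hn hF, hσ]
  refine ⟨fun η H => ?_, fun H => ?_, fun δ H => ?_⟩
  · obtain ⟨ρ, a, b, c, d, hab, H'⟩ := exists_comp_psiSix hF hs hσ hN H
    simp only [twist_add, twist_smul, twist_mono, eval_add, eval_smul, hmono1, hmono] at H'
    exact hab (psiSix_twisted h2 ind hσ6 hN H')
  · obtain ⟨ρ, a, b, c, d, hab, H'⟩ := exists_comp_psiSix hF hs hσ hN H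
    simp only [twist_mono, hmono1] at H'
    exact hab (psiSix_gabidulin ind hσ6 H')
  · rw [codeK, mono_add_half hs] at H
    obtain ⟨ρ, a, b, c, d, hab, H'⟩ := exists_comp_psiSix hF hs hσ hN H
    simp only [twist_add, twist_smul, twist_mono, eval_add, eval_smul, hmono1, hmono] at H'
    exact hab (psiSix_dickson h2 ind hσ6 hN H')

theorem not_codeEquiv_four (hodd : Odd q) (hF : Nat.card F = q ^ (2 * 4))
    (hs : Nat.Coprime (2 * 4) s) {h : F} (hh : fieldNorm q 4 2 h = -1) :
    (∀ η : F, ¬ CodeEquiv q (codeH (2 * 4) s η) (codeC q 4 s h)) ∧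
      ¬ CodeEquiv q (codeG (2 * 4) s) (codeC q 4 s h) ∧
      ∀ δ : F, ¬ CodeEquiv q (codeK (2 * 4) s δ) (codeC q 4 s h) := by
  have hn : 0 < 2 * 4 := by norm_num
  obtain ⟨σ, hσ⟩ := exists_ringHom_pow hn hF s
  have hN : h * σ (σ (σ (σ h))) = -1 := by
    rw [← hh, fieldNorm_two (by norm_num) hF hs hσ]; rfl
  have h2 := two_ne_zero_of_odd hn hF hodd
  have ind := indepEight hF hs hσ
  have hσ8 : ∀ x, σ (σ (σ (σ (σ (σ (σ (σ x))))))) = x := iterate_card hn hF hσ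
  have hmono := eval_mono_mul (F := F) hn hF hσ
  have hmono1 : ∀ x : F, eval q (mono (2 * 4) s) x = σ x := fun x => by
    rw [eval_mono q hn hF, hσ]
  refine ⟨fun η H => ?_, fun H => ?_, fun δ H => ?_⟩
  · obtain ⟨ρ, a, b, c, d, hab, H'⟩ := exists_comp_psiEight hF hs hσ hN H
    simp only [twist_add, twist_smul, twist_mono, eval_add, eval_smul, hmono1, hmono] at H'
    exact hab (psiEight_twisted h2 ind hσ8 H')
  · obtain ⟨ρ, a, b, c, d, hab, H'⟩ := exists_comp_psiEight hF hs hσ hN H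
    simp only [twist_mono, hmono1] at H'
    exact hab (psiEight_gabidulin ind hσ8 H')
  · rw [codeK, mono_add_half hs] at H
    obtain ⟨ρ, a, b, c, d, hab, H'⟩ := exists_comp_psiEight hF hs hσ hN H
    simp only [twist_add, twist_smul, twist_mono, eval_add, eval_smul, hmono1, hmono] at H'
    exact hab (psiEight_dickson h2 ind hσ8 hN H')

theorem codeEquiv_codeZ_iff (hodd : Odd q) (hF : Nat.card F = q ^ (2 * 3))
    (hs : Nat.Coprime (2 * 3) s) {h : F} (hh : fieldNorm q 3 2 h = -1) {ζ : F}
    (hζ : ζ ^ 2 + ζ = 1) :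
    CodeEquiv q (codeZ (2 * 3) ζ) (codeC q 3 s h) ↔ h ^ q = h ∧ ∃ e : ℕ, q = 5 ^ e := by
  have hn : 0 < 2 * 3 := by norm_num
  obtain ⟨σ, hσ⟩ := exists_ringHom_pow hn hF s
  have hN : h * σ (σ (σ h)) = -1 := by
    rw [← hh, fieldNorm_two (by norm_num) hF hs hσ]; rfl
  have h2 := two_ne_zero_of_odd hn hF hodd
  have ind := indepSix hF hs hσ
  have hσ6 : ∀ x, σ (σ (σ (σ (σ (σ x))))) = x := iterate_card hn hF hσ
  have hmono := eval_mono_mul (F := F) hn hF hσ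
  have hmono1 : ∀ x : F, eval q (mono (2 * 3) s) x = σ x := fun x => by
    rw [eval_mono q hn hF, hσ]
  obtain ⟨α, β, hαβ, hf⟩ := trinomial_cases hs ζ
  rw [pow_eq_self_iff (by norm_num) hF hs hσ, ← five_eq_zero_iff hn hF, codeZ, hf]
  constructor
  · intro H
    obtain ⟨ρ, a, b, c, d, hab, H'⟩ := exists_comp_psiSix hF hs hσ hN H
    simp only [twist_add, twist_smul, twist_mono, eval_add, eval_smul, hmono1, hmono] at H'
    have hζρ : ρ ζ ^ 2 + ρ ζ = 1 := by rw [← map_pow, ← map_add, hζ, map_one]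
    refine psiSix_trinomial h2 ind hσ6 hN hζρ ?_ hab H'
    rcases hαβ with ⟨rfl, rfl⟩ | ⟨rfl, rfl⟩ <;> simp
  · rintro ⟨h₁, h5⟩
    have hsq : h ^ 2 = -1 := by
      rw [h₁, h₁, h₁] at hN
      rw [sq, hN]
    have hψ := eval_psi_three hF hσ hN
    -- in characteristic five, `ζ² + ζ - 1 = (ζ - 2)²`
    have hζ2 : ζ = 2 := by
      have : (ζ - 2) ^ 2 = 0 := by linear_combination hζ + (1 - ζ) * h5
      exact sub_eq_zero.1 (pow_eq_zero_iff two_ne_zero |>.1 this)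
    subst hζ2
    rcases hαβ with ⟨rfl, rfl⟩ | ⟨rfl, rfl⟩
    · refine codeEquiv_of_comp hn hF (a := 1) (b := 1) (c := 3) (d := 2) ?_ ?_ ?_
      · norm_num
      · simpa only [hψ] using injective_add_psiSix hσ6 h5 h₁ hsq
      · intro x
        simp only [eval_add, eval_smul, hmono1, hmono, hψ, one_mul (σ _)]
        exact trinomial_comp_add_psiSix hσ6 h5 h₁ hsq x
    · refine codeEquiv_of_comp hn hF (a := -1) (b := 1) (c := 3) (d := 3) ?_ ?_ ?_
      · exact fun h0 => one_ne_zero (α := F) (by linear_combination -h0 - h5)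
      · simpa only [hψ] using injective_neg_add_psiSix hσ6 h5 h₁ hsq
      · intro x
        simp only [eval_add, eval_smul, hmono1, hmono, hψ, one_mul (_^[_] _)]
        exact trinomial_comp_neg_add_psiSix hσ6 h5 h₁ hsq x

end Finite

end QPoly

theorem mainTheorem6 {F : Type*} [Field F] [Finite F] (q t s : ℕ)
    (hq : IsPrimePow q) (hodd : Odd q) (ht : t = 3 ∨ t = 4)
    (hF : Nat.card F = q ^ (2 * t)) (hs : Nat.Coprime (2 * t) s)
    (h : F) (hh : QPoly.fieldNorm q t 2 h = -1) :
    ((∀ η : F, QPoly.fieldNorm q 1 (2 * t) η ≠ 1 →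
        ¬ QPoly.CodeEquiv q (QPoly.codeH (2 * t) s η) (QPoly.codeC q t s h)) ∧
      ¬ QPoly.CodeEquiv q (QPoly.codeG (2 * t) s) (QPoly.codeC q t s h)) ∧
    (∀ δ : F, QPoly.fieldNorm q t 2 δ ≠ 0 → QPoly.fieldNorm q t 2 δ ≠ 1 →
      ¬ QPoly.CodeEquiv q (QPoly.codeK (2 * t) s δ) (QPoly.codeC q t s h)) ∧
    (t = 3 → ∀ ζ : F, ζ ^ 2 + ζ = 1 →
      (QPoly.CodeEquiv q (QPoly.codeZ (2 * t) ζ) (QPoly.codeC q t s h) ↔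
        h ^ q = h ∧ ∃ e : ℕ, q = 5 ^ e)) := by
  rcases ht with rfl | rfl
  · obtain ⟨hH, hG, hK⟩ := QPoly.not_codeEquiv_three hodd hF hs hh
    exact ⟨⟨fun η _ => hH η, hG⟩, fun δ _ _ => hK δ,
      fun _ ζ hζ => QPoly.codeEquiv_codeZ_iff hodd hF hs hh hζ⟩
  · obtain ⟨hH, hG, hK⟩ := QPoly.not_codeEquiv_four hodd hF hs hh
    exact ⟨⟨fun η _ => hH η, hG⟩, fun δ _ _ => hK δ, fun h3 => absurd h3 (by norm_num)⟩
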